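/- Let $\mathcal G$ be a compact star graph: finitely many edges $j\in\mathcal I$, each identified with an interval $[0,a_j]$, $a_j>0$, all initial endpoints $x_j=0$ being glued together in one central vertex, while the terminal endpoints $x_j=a_j$ are pairwise distinct vertices of degree one. Let $\mathcal H=\bigoplus_{j}L^2([0,a_j];\mathbb C)$ and let $\mathcal W$ be the space of all $\psi=(\psi_j)_j\in\mathcal H$ such that each $\psi_j$ is absolutely continuous with $\psi_j'\in L^2([0,a_j])$. Put $$H^1_0(\mathcal G)=\{\psi\in\mathcal W : \psi_i(0)=\psi_j(0) \text{ and } \psi_j(a_j)=0 \text{ for all } i,j\in\mathcal I\},\qquad H^1_{*}(\mathcal G)=\Big\{\psi\in\mathcal W : \sum_{j\in\mathcal I}\psi_j(0)=0\Big\}.$$ Let $D$ be the operator $D\psi=\psi'$ in $\mathcal H$ with domain $H^1_0(\mathcal G)$, and let $D^*$ be its Hilbert space adjoint. The subspace $\operatorname{Ran}D\subset\mathcal H$ is closed; let $Q:\mathcal H\to\operatorname{Ran}D$ be the orthogonal projection onto it, so that $Q^*$ is the inclusion $\operatorname{Ran}D\to\mathcal H$. Let $A\in L^\infty(\mathcal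 G;\mathbb R)$, i.e. $A_j\in L^\infty([0,a_j];\mathbb R)$ for each $j$, let $M_A$ be the operator of multiplication by $A$ in $\mathcal H$, and suppose that $QM_AQ^*:\operatorname{Ran}D\to\operatorname{Ran}D$ is boundedly invertible. Then: (i) There is a unique self-adjoint operator $\mathcal L$ in $\mathcal H$ with $\operatorname{Dom}(\mathcal L)\subset H^1_0(\mathcal G)$ such that $\langle\varphi,\mathcal L\psi\rangle=\langle\varphi',A\psi'\rangle$ for all $\varphi\in H^1_0(\mathcal G)$ and all $\psi\in\operatorname{Dom}(\mathcal L)$. Its domain is $$\operatorname{Dom}(\mathcal L)=\{\psi\in H^1_0(\mathcal G) : M_AD\psi\in H^1_{*}(\mathcal G)\},$$ for every $\psi\in\operatorname{Dom}(\mathcal L)$ one has $M_AD\psi\in\operatorname{Dom}(D^*)$ and $\mathcal L\psi=D^*M_AD\psi$, and $\operatorname{Dom}(\mathcal L)$ is a core for $D$. (ii) $\mathcal L$ is boundedly invertible and $\mathcal L^{-1}$ is compact. The spectrum of $\mathcal L$ is purely discrete, i.e. it consists of isolated points which are eigenvalues of finite multiplicity. -/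

import Mathlib

open MeasureTheory Set Filter
open scoped ENNReal InnerProductSpace

/-- A compact star graph with edge set `I`: every edge is an interval `[0, length j]` of positive
length, all initial vertices (`x = 0`) coincide, and the terminal vertices (`x = length j`) are
pairwise distinct and different from the initial vertex, i.e. they have degree one. -/
structure CompactStarGraph (V I : Type*) where
  init : I → V
  term : I → V
  length : I → ℝ
  init_eq : ∀ i j, init i = init j
  term_injective : Function.Injective term
  term_ne_init : ∀ i j, term i ≠ init j
  length_pos : ∀ j, 0 < length j

namespace CompactStarGraph

variable {V I : Type*} (G : CompactStarGraph V I)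

/-- Lebesgue measure on the edge `[0, length j]`. -/
noncomputable def edgeMeasure (j : I) : Measure ℝ := volume.restrict (Icc 0 (G.length j))

instance (j : I) : IsFiniteMeasure (G.edgeMeasure j) := by
  unfold edgeMeasure; infer_instance

/-- The Hilbert space of the graph, the orthogonal sum of the complex spaces
`L²([0, length j])`. -/
abbrev L2 [Fintype I] : Type _ := PiLp 2 fun j => Lp ℂ 2 (G.edgeMeasure j)

/-- The space `L^∞` of real functions on the graph. -/
abbrev RealLinfty : Type _ := ∀ j, Lp ℝ ∞ (G.edgeMeasure j)

/-- The function `ψ` on the graph has on each edge the absolutely continuous representative `F j`,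
whose derivative is almost everywhere equal to the square integrable function `ψ' j`. -/
structure IsACRep [Fintype I] (ψ ψ' : G.L2) (F : I → ℝ → ℂ) : Prop where
  ac : ∀ j, AbsolutelyContinuousOnInterval (F j) 0 (G.length j)
  ae_eq : ∀ j, ψ j =ᵐ[G.edgeMeasure j] F j
  hasDeriv : ∀ j, ∀ᵐ x ∂(G.edgeMeasure j), HasDerivAt (F j) (ψ' j x) x

section AC

theorem ac_const (c : ℂ) (a b : ℝ) : AbsolutelyContinuousOnInterval (fun _ : ℝ => c) a b :=
  LipschitzOnWith.absolutelyContinuousOnInterval (K := 0)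
    (fun _ _ _ _ => by simp)

theorem ac_ofReal {f : ℝ → ℝ} {a b : ℝ} (hf : AbsolutelyContinuousOnInterval f a b) (c : ℂ) :
    AbsolutelyContinuousOnInterval (fun x => (f x : ℂ) * c) a b := by
  have h := hf.smul (ac_const c a b)
  have e : ((fun x => f x) • fun _ => c) = fun x => (f x : ℂ) * c := by
    ext x
    simp
  exact e ▸ h

theorem ac_integral {g : ℝ → ℂ} {a b c : ℝ} (hg : IntervalIntegrable g volume a b)
    (hc : c ∈ uIcc a b) : AbsolutelyContinuousOnInterval (fun x => ∫ t in c..x, g t) a b := by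
  have hr : IntervalIntegrable (fun t => (g t).re) volume a b :=
    ⟨hg.1.re, hg.2.re⟩
  have hi : IntervalIntegrable (fun t => (g t).im) volume a b :=
    ⟨hg.1.im, hg.2.im⟩
  have h := (ac_ofReal (hr.absolutelyContinuousOnInterval_intervalIntegral hc) 1).add
    (ac_ofReal (hi.absolutelyContinuousOnInterval_intervalIntegral hc) Complex.I)
  rw [absolutelyContinuousOnInterval_iff] at h ⊢
  intro ε hε
  obtain ⟨δ, hδ, H⟩ := h ε hε
  refine ⟨δ, hδ, fun E hE hl => ?_⟩
  have key : ∀ x ∈ uIcc a b, (∫ t in c..x, g t) =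
      ((fun x => (((∫ t in c..x, (g t).re : ℝ)) : ℂ) * 1) +
        fun x => (((∫ t in c..x, (g t).im : ℝ)) : ℂ) * Complex.I) x := by
    intro x hx
    have hgx : IntervalIntegrable g volume c x := hg.mono_set (uIcc_subset_uIcc hc hx)
    have hrx : IntervalIntegrable (fun t => (g t).re) volume c x := ⟨hgx.1.re, hgx.2.re⟩
    have hix : IntervalIntegrable (fun t => (g t).im) volume c x := ⟨hgx.1.im, hgx.2.im⟩
    simp only [Pi.add_apply, mul_one]
    rw [← intervalIntegral.integral_ofReal, ← intervalIntegral.integral_ofReal,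
      ← intervalIntegral.integral_mul_const, ← intervalIntegral.integral_add]
    · simp only [Complex.re_add_im]
    · exact ⟨hrx.1.ofReal, hrx.2.ofReal⟩
    · exact IntervalIntegrable.mul_const ⟨hix.1.ofReal, hix.2.ofReal⟩ _
  refine lt_of_eq_of_lt (Finset.sum_congr rfl fun i hi => ?_) (H E hE hl)
  rw [key _ (hE.1 i hi).1, key _ (hE.1 i hi).2]

/-- The fundamental theorem of calculus for complex absolutely continuous functions. -/
theorem ac_ftc {F g : ℝ → ℂ} {a b : ℝ} (hF : AbsolutelyContinuousOnInterval F a b)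
    (hg : IntervalIntegrable g volume a b)
    (hd : ∀ᵐ x, x ∈ uIcc a b → HasDerivAt F (g x) x) :
    ∫ t in a..b, g t = F b - F a := by
  have h1 := hF.sub (ac_integral hg left_mem_uIcc)
  have h2 : ∀ᵐ x, x ∈ uIcc a b → HasDerivAt (F - fun x => ∫ t in a..x, g t) 0 x := by
    filter_upwards [hd, hg.ae_hasDerivAt_integral] with x hx hx' hm
    simpa using (hx hm).sub (hx' hm a left_mem_uIcc)
  obtain ⟨C, hC⟩ := h1.const_of_ae_hasDerivAt_zero h2
  have ha := hC a left_mem_uIcc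
  have hb := hC b right_mem_uIcc
  simp only [Pi.sub_apply, intervalIntegral.integral_same, sub_zero] at ha hb
  rw [ha, ← hb]
  ring

end AC

variable {G} [Fintype I]

namespace IsACRep

variable {ψ ψ' φ φ' : G.L2} {F E : I → ℝ → ℂ}

theorem zero : G.IsACRep 0 0 (fun _ _ => 0) where
  ac j := ac_const 0 _ _
  ae_eq j := Lp.coeFn_zero _ _ _
  hasDeriv j := by
    filter_upwards [Lp.coeFn_zero ℂ 2 (G.edgeMeasure j)] with x hx
    simp only [PiLp.zero_apply, hx, Pi.zero_apply]
    exact hasDerivAt_const x 0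

theorem add (h : G.IsACRep ψ ψ' F) (k : G.IsACRep φ φ' E) :
    G.IsACRep (ψ + φ) (ψ' + φ') (F + E) where
  ac j := (h.ac j).add (k.ac j)
  ae_eq j := (Lp.coeFn_add (ψ j) (φ j)).trans ((h.ae_eq j).add (k.ae_eq j))
  hasDeriv j := by
    filter_upwards [Lp.coeFn_add (ψ' j) (φ' j), h.hasDeriv j, k.hasDeriv j] with x hx h1 h2
    simp only [PiLp.add_apply, hx, Pi.add_apply]
    exact h1.add h2

theorem smul (c : ℂ) (h : G.IsACRep ψ ψ' F) : G.IsACRep (c • ψ) (c • ψ') (c • F) where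
  ac j := (h.ac j).const_smul c
  ae_eq j := (Lp.coeFn_smul c (ψ j)).trans ((h.ae_eq j).const_smul c)
  hasDeriv j := by
    filter_upwards [Lp.coeFn_smul c (ψ' j), h.hasDeriv j] with x hx h1
    simp only [PiLp.smul_apply, hx, Pi.smul_apply]
    exact h1.const_smul c

/-- The derivative does not depend on the representatives. -/
theorem deriv_unique (h : G.IsACRep ψ ψ' F) (k : G.IsACRep ψ φ' E) : ψ' = φ' := by
  ext1 j
  refine Lp.ext ?_
  have hpos := G.length_pos j
  have hEq : EqOn (F j) (E j) (Icc 0 (G.length j)) := by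
    refine Measure.eqOn_Icc_of_ae_eq volume hpos.ne
      ((h.ae_eq j).symm.trans (k.ae_eq j)) ?_ ?_
    · simpa [uIcc_of_le hpos.le] using (h.ac j).continuousOn
    · simpa [uIcc_of_le hpos.le] using (k.ac j).continuousOn
  have hIoo : ∀ᵐ x ∂(G.edgeMeasure j), x ∈ Ioo 0 (G.length j) := by
    rw [edgeMeasure, restrict_Ioo_eq_restrict_Icc.symm]
    exact ae_restrict_mem measurableSet_Ioo
  filter_upwards [h.hasDeriv j, k.hasDeriv j, hIoo] with x h1 h2 hx
  refine h1.unique (h2.congr_of_eventuallyEq ?_)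
  filter_upwards [isOpen_Ioo.mem_nhds hx] with y hy
  exact hEq (Ioo_subset_Icc_self hy)

end IsACRep

variable (G)

/-- `H₀¹(G)`: functions with absolutely continuous representatives and square integrable derivative
that are continuous at the central vertex and vanish at all terminal vertices. -/
def H10 : Submodule ℂ G.L2 where
  carrier := {ψ | ∃ ψ' F, G.IsACRep ψ ψ' F ∧ (∀ i j, F i 0 = F j 0) ∧ ∀ j, F j (G.length j) = 0}
  zero_mem' := ⟨0, _, .zero, fun _ _ => rfl, fun _ => rfl⟩
  add_mem' := by
    rintro ψ φ ⟨ψ', F, h, hF, hF'⟩ ⟨φ', E, k, hE, hE'⟩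
    exact ⟨_, _, h.add k, fun i j => by simp [hF i j, hE i j], fun j => by simp [hF', hE']⟩
  smul_mem' := by
    rintro c ψ ⟨ψ', F, h, hF, hF'⟩
    exact ⟨_, _, h.smul c, fun i j => by simp [hF i j], fun j => by simp [hF']⟩

/-- Functions with absolutely continuous representatives and square integrable derivative whose
boundary values at the central vertex add up to zero; there is no condition at the terminal
vertices. -/
def fluxH1 : Submodule ℂ G.L2 where
  carrier := {ψ | ∃ ψ' F, G.IsACRep ψ ψ' F ∧ ∑ j, F j 0 = 0}
  zero_mem' := ⟨0, _, .zero, by simp⟩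
  add_mem' := by
    rintro ψ φ ⟨ψ', F, h, hF⟩ ⟨φ', E, k, hE⟩
    exact ⟨_, _, h.add k, by simp [Finset.sum_add_distrib, hF, hE]⟩
  smul_mem' := by
    rintro c ψ ⟨ψ', F, h, hF⟩
    exact ⟨_, _, h.smul c, by simp [← Finset.mul_sum, hF]⟩

variable {G}

theorem exists_rep (ψ : G.H10) : ∃ ψ' F, G.IsACRep (ψ : G.L2) ψ' F ∧ (∀ i j, F i 0 = F j 0) ∧
    ∀ j, F j (G.length j) = 0 := ψ.2

variable (G)

/-- The gradient `D ψ = ψ'` as an operator in `L²(G)` with domain `H₀¹(G)`. -/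
noncomputable def gradient : G.L2 →ₗ.[ℂ] G.L2 where
  domain := G.H10
  toFun :=
    { toFun := fun ψ => (exists_rep ψ).choose
      map_add' := fun ψ φ => by
        obtain ⟨_, h, -⟩ := (exists_rep (ψ + φ)).choose_spec
        obtain ⟨_, h1, -⟩ := (exists_rep ψ).choose_spec
        obtain ⟨_, h2, -⟩ := (exists_rep φ).choose_spec
        exact h.deriv_unique (h1.add h2)
      map_smul' := fun c ψ => by
        obtain ⟨_, h, -⟩ := (exists_rep (c • ψ)).choose_spec
        obtain ⟨_, h1, -⟩ := (exists_rep ψ).choose_spec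
        exact h.deriv_unique (h1.smul c) }

variable {G}

theorem gradient_spec (ψ : G.gradient.domain) :
    ∃ F, G.IsACRep (ψ : G.L2) (G.gradient ψ) F ∧ (∀ i j, F i 0 = F j 0) ∧
      ∀ j, F j (G.length j) = 0 :=
  (exists_rep ψ).choose_spec

theorem gradient_eq (ψ : G.gradient.domain) {ψ' : G.L2} {F : I → ℝ → ℂ}
    (h : G.IsACRep (ψ : G.L2) ψ' F) : G.gradient ψ = ψ' := by
  obtain ⟨_, h1, -⟩ := gradient_spec ψ
  exact h1.deriv_unique h

variable (G)

/-- The range of the gradient. -/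
noncomputable def gradientRange : Submodule ℂ G.L2 := LinearMap.range G.gradient.toFun

variable {G}

theorem intervalIntegrable_L2 (g : G.L2) (j : I) :
    IntervalIntegrable (g j) volume 0 (G.length j) := by
  rw [intervalIntegrable_iff_integrableOn_Icc_of_le (G.length_pos j).le]
  exact (Lp.memLp (g j)).integrable (by norm_num)

theorem integral_edge (g : ℝ → ℂ) (j : I) :
    ∫ x, g x ∂(G.edgeMeasure j) = ∫ x in 0..G.length j, g x := by
  rw [intervalIntegral.integral_of_le (G.length_pos j).le, edgeMeasure,
    restrict_Ioc_eq_restrict_Icc]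

theorem ae_edge {p : ℝ → Prop} (j : I) :
    (∀ᵐ x ∂(G.edgeMeasure j), p x) ↔ ∀ᵐ x, x ∈ uIcc 0 (G.length j) → p x := by
  rw [edgeMeasure, ae_restrict_iff' measurableSet_Icc, uIcc_of_le (G.length_pos j).le]

/-- The range of the gradient consists of all functions whose integrals over the edges agree. -/
theorem mem_gradientRange_iff (g : G.L2) : g ∈ G.gradientRange ↔
    ∀ i j, ∫ x, g i x ∂(G.edgeMeasure i) = ∫ x, g j x ∂(G.edgeMeasure j) := by
  constructor
  · rintro ⟨ψ, rfl⟩ i j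
    obtain ⟨F, h, h0, h1⟩ := gradient_spec ψ
    have key : ∀ j, ∫ x, (G.gradient ψ) j x ∂(G.edgeMeasure j) = - F j 0 := fun j => by
      rw [integral_edge, ac_ftc (h.ac j) (intervalIntegrable_L2 _ j)
        ((ae_edge j).1 (h.hasDeriv j)), h1 j, zero_sub]
    exact (key i).trans ((congrArg Neg.neg (h0 i j)).trans (key j).symm)
  · intro hg
    let F : I → ℝ → ℂ := fun j x => ∫ t in (G.length j)..x, g j t
    have hac : ∀ j, AbsolutelyContinuousOnInterval (F j) 0 (G.length j) := fun j =>
      ac_integral (intervalIntegrable_L2 g j) right_mem_uIcc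
    have hmem : ∀ j, MemLp (F j) 2 (G.edgeMeasure j) := fun j => by
      obtain ⟨C, hC⟩ := (hac j).exists_bound
      have hcont := (hac j).continuousOn
      rw [uIcc_of_le (G.length_pos j).le] at hC hcont
      refine MemLp.of_bound (hcont.aestronglyMeasurable measurableSet_Icc) C ?_
      exact (ae_restrict_iff' measurableSet_Icc).2 (Eventually.of_forall hC)
    have hrep : G.IsACRep (WithLp.toLp 2 fun j => (hmem j).toLp (F j)) g F :=
      { ac := hac
        ae_eq := fun j => (hmem j).coeFn_toLp
        hasDeriv := fun j => by
          rw [ae_edge]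
          filter_upwards [(intervalIntegrable_L2 g j).ae_hasDerivAt_integral] with x hx hm
          exact hx hm _ right_mem_uIcc }
    have hdom : (WithLp.toLp 2 fun j => (hmem j).toLp (F j)) ∈ G.gradient.domain := by
      refine ⟨g, F, hrep, fun i j => ?_, fun j => intervalIntegral.integral_same⟩
      have := hg i j
      rw [integral_edge, integral_edge] at this
      simp only [F]
      rw [intervalIntegral.integral_symm, this, ← intervalIntegral.integral_symm]
    exact ⟨⟨_, hdom⟩, gradient_eq ⟨_, hdom⟩ hrep⟩

theorem isClosed_gradientRange : IsClosed (G.gradientRange : Set G.L2) := by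
  have hc : ∀ i, Continuous fun g : G.L2 => ∫ x, g i x ∂(G.edgeMeasure i) := fun i => by
    have h : ∀ g : G.L2, ∫ x, g i x ∂(G.edgeMeasure i) =
        ⟪indicatorConstLp 2 MeasurableSet.univ (measure_ne_top (G.edgeMeasure i) _) (1 : ℂ),
          g i⟫_ℂ := fun g => by
      rw [L2.inner_indicatorConstLp_one, Measure.restrict_univ]
    simp only [h]
    fun_prop
  have hs : (G.gradientRange : Set G.L2) = ⋂ i, ⋂ j, {g : G.L2 |
      ∫ x, g i x ∂(G.edgeMeasure i) = ∫ x, g j x ∂(G.edgeMeasure j)} := by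
    ext g
    simp only [SetLike.mem_coe, mem_gradientRange_iff, mem_iInter, mem_ofPred_eq]
  rw [hs]
  exact isClosed_iInter fun i => isClosed_iInter fun j => isClosed_eq (hc i) (hc j)

instance : CompleteSpace G.gradientRange :=
  isClosed_gradientRange.completeSpace_coe

/-- The multiplication operator `M_A` on `L²(G)`. -/
noncomputable def mulOp (A : G.RealLinfty) : G.L2 →L[ℂ] G.L2 :=
  (PiLp.continuousLinearEquiv 2 ℂ fun j => Lp ℂ 2 (G.edgeMeasure j)).symm.toContinuousLinearMap ∘L
    ContinuousLinearMap.piMap (fun j =>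
      (ContinuousLinearMap.mul ℂ ℂ).holderL (G.edgeMeasure j) ∞ 2 2
        (Complex.ofRealCLM.compLp (A j))) ∘L
    (PiLp.continuousLinearEquiv 2 ℂ fun j => Lp ℂ 2 (G.edgeMeasure j)).toContinuousLinearMap

theorem mulOp_ae (A : G.RealLinfty) (φ : G.L2) (j : I) :
    mulOp A φ j =ᵐ[G.edgeMeasure j] fun x => (A j x : ℂ) * φ j x := by
  have h := (ContinuousLinearMap.mul ℂ ℂ).coeFn_holder (r := 2)
    (Complex.ofRealCLM.compLp (A j)) (φ j)
  have h2 := Complex.ofRealCLM.coeFn_compLp' (A j)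
  filter_upwards [h, h2] with x hx hx2
  have e : mulOp A φ j x = (ContinuousLinearMap.mul ℂ ℂ).holder 2
    (Complex.ofRealCLM.compLp (A j)) (φ j) x := rfl
  rw [e, hx, hx2]
  rfl

/-- The compression `Q M_A Q*` of `M_A` to `Ran D`, where `Q` is the orthogonal projection of
`L²(G)` onto `Ran D` and `Q*` is the inclusion. -/
noncomputable def compression (A : G.RealLinfty) : G.gradientRange →L[ℂ] G.gradientRange :=
  G.gradientRange.orthogonalProjectionOnto ∘L mulOp A ∘L G.gradientRange.subtypeL

/-- `L` is a self-adjoint operator with domain in `H₀¹(G)` that represents the form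
`⟨φ', A ψ'⟩`. -/
structure Represents (A : G.RealLinfty) (L : G.L2 →ₗ.[ℂ] G.L2) : Prop where
  selfAdjoint : IsSelfAdjoint L
  domain_le : L.domain ≤ G.gradient.domain
  form_eq : ∀ (φ : G.gradient.domain) (ψ : L.domain),
    ⟪(φ : G.L2), L ψ⟫_ℂ = ⟪G.gradient φ, mulOp A (G.gradient ⟨ψ, domain_le ψ.2⟩)⟫_ℂ

end CompactStarGraph

section Unbounded

variable {H : Type*} [NormedAddCommGroup H] [InnerProductSpace ℂ H]

/-- The everywhere defined bounded operator `R` is a two-sided inverse of the unbounded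
operator `T`. -/
def IsBoundedInverse (T : H →ₗ.[ℂ] H) (R : H →L[ℂ] H) : Prop :=
  (∀ f, ∃ h : R f ∈ T.domain, T ⟨R f, h⟩ = f) ∧ ∀ ψ : T.domain, R (T ψ) = ψ

/-- The operator `T - z`, with the same domain as `T`. -/
def subScalar (T : H →ₗ.[ℂ] H) (z : ℂ) : H →ₗ.[ℂ] H where
  domain := T.domain
  toFun := T.toFun - z • T.domain.subtype

/-- The spectrum of an unbounded operator: all `z` such that `T - z` is not boundedly
invertible. -/
def unboundedSpectrum (T : H →ₗ.[ℂ] H) : Set ℂ :=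
  {z | ¬ ∃ R, IsBoundedInverse (subScalar T z) R}

/-- The eigenspace `ker (T - z)`, as a subspace of the domain. -/
def unboundedEigenspace (T : H →ₗ.[ℂ] H) (z : ℂ) : Submodule ℂ T.domain :=
  (T.toFun - z • T.domain.subtype).ker

/-- The spectrum of the self-adjoint operator `T` is purely discrete: it consists of isolated
points that are eigenvalues of finite multiplicity. -/
def HasDiscreteSpectrum (T : H →ₗ.[ℂ] H) : Prop :=
  ∀ z ∈ unboundedSpectrum T, ¬ AccPt z (𝓟 (unboundedSpectrum T)) ∧
    unboundedEigenspace T z ≠ ⊥ ∧ FiniteDimensional ℂ (unboundedEigenspace T z)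

end Unbounded

/-!
The operator `L` is constructed through its inverse. The gradient `D` is injective with closed range
`R`, and its inverse `K : R → L²` is integration from the terminal vertices, a compact operator:
`g ↦ ∫ t in length j..x, g t` is minus the inner product with an indicator function depending
continuously on `x`, so the Arzelà–Ascoli theorem applies (`isCompactOperator_innerOperator`).
With `B = Q M_A Q*`, the weak equation `⟪D φ, A D ψ⟫ = ⟪φ, f⟫` for all `φ` in the domain of `D` says
that `B D ψ = K† f`, that is, `ψ = T f` with `T = K B⁻¹ K†`
(`IsRangeInverse.sandwich_eq_iff`, `CompactStarGraph.exists_solutionOperator`).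
No sign of `A` is needed here, only invertibility of `B`.

The operator `T` is compact and symmetric, and it is injective because the domain of `D` is dense.
Hence `L = T⁻¹` is self-adjoint (`IsBoundedInverse.isSelfAdjoint`). Any other operator representing
the form is a restriction of `L`, and a self-adjoint operator has no proper self-adjoint
restriction (`IsSelfAdjoint.eq_of_le`). The domain of `L` is `K` applied to the dense subspace
`Ran (B⁻¹ K†)` of `R`, hence a core for `D` (`IsRangeInverse.hasCore`).

The description of the domain comes from `weak_gradient_iff`: the adjoint of `D` is minus the
derivative on the functions satisfying the flux condition. One direction is integration by parts.
For the other one, subtract from `g` the primitive of `-D† g` vanishing at the central vertex; the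
difference is orthogonal to `R`, and `Rᗮ` consists of the edgewise constants with vanishing sum.
The same lemma, applied to `g = 0`, gives the density of the domain of `D`.

For the discreteness of the spectrum, `z` is in the spectrum of `L` only if `z ≠ 0` and `z⁻¹` is in
the spectrum of `T`, where by the Fredholm alternative it is an eigenvalue of finite multiplicity.
It is isolated because `T` composed with the projection onto the complement of the eigenspace has
`z⁻¹` in its open resolvent set (`IsCompactOperator.eventually_notMem_spectrum`).
-/

section Abstract

variable {H : Type*} [NormedAddCommGroup H] [InnerProductSpace ℂ H]

/-! ### Adjoints of unbounded operators -/

theorem LinearPMap.exists_adjoint_apply_eq [CompleteSpace H] {D : H →ₗ.[ℂ] H}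
    (hD : Dense (D.domain : Set H)) {g w : H} (h : ∀ φ : D.domain, ⟪w, (φ : H)⟫_ℂ = ⟪g, D φ⟫_ℂ) :
    ∃ h' : g ∈ D.adjoint.domain, w = D.adjoint ⟨g, h'⟩ :=
  ⟨D.mem_adjoint_domain_of_exists g ⟨w, h⟩, (LinearPMap.adjoint_apply_eq hD _ h).symm⟩

/-- Self-adjoint operators have no proper self-adjoint extensions. -/
theorem IsSelfAdjoint.eq_of_le [CompleteSpace H] {L L' : H →ₗ.[ℂ] H} (hL : IsSelfAdjoint L)
    (hL' : IsSelfAdjoint L') (hle : L' ≤ L) : L' = L := by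
  refine le_antisymm hle ?_
  have hform : L.IsFormalAdjoint L := by
    have := LinearPMap.adjoint_isFormalAdjoint hL.dense_domain
    rwa [LinearPMap.isSelfAdjoint_def.1 hL] at this
  have h : L'.IsFormalAdjoint L := fun x y => by
    rw [hle.2 (x := x) (y := ⟨x, hle.1 x.2⟩) rfl]
    exact hform ⟨x, hle.1 x.2⟩ y
  exact (h.le_adjoint hL'.dense_domain).trans_eq (LinearPMap.isSelfAdjoint_def.1 hL')

/-! ### Unbounded operators with a bounded inverse -/

/-- The unbounded inverse of an injective bounded operator; its domain is the range. -/
noncomputable def unboundedInverse (T : H →L[ℂ] H) (hT : Function.Injective T) : H →ₗ.[ℂ] H where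
  domain := LinearMap.range T.toLinearMap
  toFun := (LinearEquiv.ofInjective T.toLinearMap hT).symm

theorem isBoundedInverse_unboundedInverse (T : H →L[ℂ] H) (hT : Function.Injective T) :
    IsBoundedInverse (unboundedInverse T hT) T :=
  ⟨fun f => ⟨⟨f, rfl⟩, (LinearEquiv.ofInjective T.toLinearMap hT).symm_apply_apply f⟩,
    fun ψ => congrArg Subtype.val
      ((LinearEquiv.ofInjective T.toLinearMap hT).apply_symm_apply ψ)⟩

theorem LinearMap.IsSymmetric.dense_range [CompleteSpace H] {T : H →L[ℂ] H}
    (hT : T.toLinearMap.IsSymmetric) (hinj : Function.Injective T) :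
    Dense (LinearMap.range T.toLinearMap : Set H) := by
  rw [Submodule.dense_iff_topologicalClosure_eq_top, Submodule.topologicalClosure_eq_top_iff,
    hT.orthogonal_range]
  exact LinearMap.ker_eq_bot.2 hinj

theorem isBoundedInverse_subScalar {L : H →ₗ.[ℂ] H} {z : ℂ} {S : H →L[ℂ] H}
    (h1 : ∀ f, ∃ h : S f ∈ L.domain, L ⟨S f, h⟩ - z • S f = f)
    (h2 : ∀ ψ : L.domain, S (L ψ - z • (ψ : H)) = ψ) : IsBoundedInverse (subScalar L z) S :=
  ⟨h1, h2⟩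

namespace IsBoundedInverse

variable {L : H →ₗ.[ℂ] H} {T : H →L[ℂ] H}

theorem mem_domain (h : IsBoundedInverse L T) (f : H) : T f ∈ L.domain := (h.1 f).1

theorem apply_apply (h : IsBoundedInverse L T) (f : H) : L ⟨T f, h.mem_domain f⟩ = f := (h.1 f).2

theorem injective (h : IsBoundedInverse L T) : Function.Injective T := by
  intro f g hfg
  rw [← h.apply_apply f, ← h.apply_apply g]
  simp only [hfg]

theorem domain_eq_range (h : IsBoundedInverse L T) : L.domain = LinearMap.range T.toLinearMap := by
  ext ψ
  exact ⟨fun hψ => ⟨L ⟨ψ, hψ⟩, h.2 ⟨ψ, hψ⟩⟩, fun ⟨f, hf⟩ => hf ▸ h.mem_domain f⟩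

/-- The inverse of an injective bounded symmetric operator is self-adjoint. -/
theorem isSelfAdjoint [CompleteSpace H] (h : IsBoundedInverse L T)
    (hT : T.toLinearMap.IsSymmetric) : IsSelfAdjoint L := by
  have hdense : Dense (L.domain : Set H) := by
    rw [h.domain_eq_range]
    exact hT.dense_range h.injective
  have hsymm : L.IsFormalAdjoint L := by
    intro x y
    conv_lhs => rw [← h.2 y]
    conv_rhs => rw [← h.2 x]
    exact (hT _ _).symm
  rw [LinearPMap.isSelfAdjoint_def]
  -- every `y` in the domain of the adjoint is `T (L† y)`, hence lies in the domain of `L`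
  refine (LinearPMap.eq_of_le_of_domain_eq (hsymm.le_adjoint hdense)
    (le_antisymm (hsymm.le_adjoint hdense).1 fun y hy => ?_)).symm
  have key : T (L.adjoint ⟨y, hy⟩) = y := by
    refine ext_inner_right ℂ fun g => ?_
    refine (hT _ g).trans ?_
    exact (LinearPMap.adjoint_isFormalAdjoint hdense ⟨y, hy⟩ ⟨T g, h.mem_domain g⟩).trans
      (by rw [h.apply_apply])
  rw [← key]
  exact h.mem_domain _

theorem apply_eq_smul_iff (h : IsBoundedInverse L T) {z : ℂ} (hz : z ≠ 0) (ψ : L.domain) :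
    L ψ = z • (ψ : H) ↔ T ψ = z⁻¹ • (ψ : H) := by
  rw [← h.injective.eq_iff, h.2, map_smul, eq_inv_smul_iff₀ hz, eq_comm]

/-- Away from the reciprocals of the spectrum of `T = L⁻¹`, the resolvent is
`(L - z)⁻¹ = z⁻¹ T (z⁻¹ - T)⁻¹`. -/
theorem inv_mem_spectrum (h : IsBoundedInverse L T) {z : ℂ} (hz : z ∈ unboundedSpectrum L) :
    z ≠ 0 ∧ z⁻¹ ∈ spectrum ℂ T := by
  have hz0 : z ≠ 0 := by
    rintro rfl
    refine hz ⟨T, isBoundedInverse_subScalar (fun f => ⟨h.mem_domain f, ?_⟩) fun ψ => ?_⟩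
    · rw [zero_smul, sub_zero, h.apply_apply]
    · rw [zero_smul, sub_zero, h.2]
  refine ⟨hz0, fun hu => hz ?_⟩
  rw [spectrum.mem_resolventSet_iff] at hu
  obtain ⟨u, hu⟩ := hu
  have hu1 : ∀ f, z⁻¹ • (u⁻¹.1 f) - T (u⁻¹.1 f) = f := fun f => by
    have := congrArg (fun S : H →L[ℂ] H => S f) u.mul_inv
    rw [hu] at this
    simpa [Algebra.algebraMap_eq_smul_one] using this
  have hu2 : ∀ f, u⁻¹.1 (z⁻¹ • f - T f) = f := fun f => by
    have := congrArg (fun S : H →L[ℂ] H => S f) u.inv_mul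
    rw [hu] at this
    simpa [Algebra.algebraMap_eq_smul_one] using this
  refine ⟨z⁻¹ • T ∘L u⁻¹.1, isBoundedInverse_subScalar (fun f => ?_) fun ψ => ?_⟩
  · have hm : (z⁻¹ • T ∘L u⁻¹.1) f = T (z⁻¹ • u⁻¹.1 f) := by simp
    rw [hm]
    refine ⟨h.mem_domain _, ?_⟩
    rw [h.apply_apply, map_smul, smul_inv_smul₀ hz0, hu1]
  · have e : L ψ - z • (ψ : H) = z • (z⁻¹ • L ψ - T (L ψ)) := by
      rw [h.2, smul_sub, smul_inv_smul₀ hz0]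
    have hm : ∀ f, (z⁻¹ • T ∘L u⁻¹.1) (z • f) = T (u⁻¹.1 f) := fun f => by
      simp [smul_smul, hz0]
    rw [e, hm, hu2, h.2]

end IsBoundedInverse

/-! ### Discreteness of the spectrum -/

/-- The nonzero spectral values of a compact symmetric operator are isolated: removing the
eigenspace at `c` from `T` gives a compact operator with `c` in its resolvent set,
which is open; near `c`, both operators have the same eigenvectors. -/
theorem IsCompactOperator.eventually_notMem_spectrum [CompleteSpace H] {T : H →L[ℂ] H}
    (hc : IsCompactOperator T) (hT : T.toLinearMap.IsSymmetric) {c : ℂ} (hc0 : c ≠ 0) :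
    ∀ᶠ μ in nhds c, μ ≠ c → μ ∉ spectrum ℂ T := by
  let E := Module.End.eigenspace T.toLinearMap c
  have : FiniteDimensional ℂ E := T.finite_dimensional_eigenspace hc c hc0
  let T' : H →L[ℂ] H := T ∘L Eᗮ.starProjection
  have hc' : IsCompactOperator T' := hc.comp_clm _
  have hcr : c ∈ resolventSet ℂ T' := by
    by_contra hcs
    obtain ⟨x, hx, hx0⟩ := ((hc'.hasEigenvalue_iff_mem_spectrum hc0).2 hcs).exists_hasEigenvector
    have hx : T (Eᗮ.starProjection x) = c • x := Module.End.mem_eigenspace_iff.1 hx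
    have hinv : ∀ v ∈ Eᗮ, T v ∈ Eᗮ := hT.invariant_orthogonalComplement_eigenspace c
    -- an eigenvector `x` of `T'` at `c` would lie in `Eᗮ` and in `E`
    have hxE : x ∈ Eᗮ := by
      have := hinv _ (Eᗮ.starProjection_apply_mem x)
      rw [hx] at this
      exact (Submodule.smul_mem_iff _ hc0).1 this
    rw [Submodule.starProjection_eq_self_iff.2 hxE] at hx
    exact hx0 (inner_self_eq_zero.1 (hxE x (Module.End.mem_eigenspace_iff.2 hx)) :)
  filter_upwards [(spectrum.isOpen_resolventSet T').mem_nhds hcr,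
    isOpen_ne.mem_nhds hc0] with μ hμ hμ0 hne hs
  obtain ⟨x, hx, hx0⟩ := ((hc.hasEigenvalue_iff_mem_spectrum hμ0).2 hs).exists_hasEigenvector
  have hxE : x ∈ Eᗮ := fun v hv =>
    hT.orthogonalFamily_eigenspaces hne.symm (⟨v, hv⟩ : E) ⟨x, hx⟩
  refine (hc'.hasEigenvalue_iff_mem_spectrum hμ0).1
    (Module.End.hasEigenvalue_of_hasEigenvector ⟨?_, hx0⟩) hμ
  rw [Module.End.mem_eigenspace_iff] at hx ⊢
  refine Eq.trans ?_ hx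
  change T (Eᗮ.starProjection x) = T x
  rw [Submodule.starProjection_eq_self_iff.2 hxE]

/-- An operator with compact symmetric inverse has purely discrete spectrum. -/
theorem IsBoundedInverse.hasDiscreteSpectrum [CompleteSpace H] {L : H →ₗ.[ℂ] H} {T : H →L[ℂ] H}
    (h : IsBoundedInverse L T) (hc : IsCompactOperator T) (hT : T.toLinearMap.IsSymmetric) :
    HasDiscreteSpectrum L := by
  intro z hz
  obtain ⟨hz0, hzs⟩ := h.inv_mem_spectrum hz
  have hmem : ∀ ψ : L.domain, ψ ∈ unboundedEigenspace L z ↔ L ψ = z • (ψ : H) := fun ψ => by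
    rw [unboundedEigenspace, LinearMap.mem_ker, LinearMap.sub_apply, sub_eq_zero]
    rfl
  refine ⟨?_, ?_, ?_⟩
  · rw [accPt_iff_frequently, not_frequently]
    filter_upwards [(continuousAt_inv₀ hz0).eventually
      (hc.eventually_notMem_spectrum hT (inv_ne_zero hz0))] with w hw hwz
    exact hw (inv_injective.ne hwz.1) (h.inv_mem_spectrum hwz.2).2
  · obtain ⟨x, hx, hx0⟩ :=
      ((hc.hasEigenvalue_iff_mem_spectrum (inv_ne_zero hz0)).2 hzs).exists_hasEigenvector
    have hx : T x = z⁻¹ • x := Module.End.mem_eigenspace_iff.1 hx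
    have hxd : x ∈ L.domain := by
      have := L.domain.smul_mem z (h.mem_domain x)
      rwa [hx, smul_inv_smul₀ hz0] at this
    exact (Submodule.ne_bot_iff _).2 ⟨⟨x, hxd⟩, (hmem _).2 ((h.apply_eq_smul_iff hz0 _).2 hx),
      fun h0 => hx0 (congrArg Subtype.val h0)⟩
  · have := T.finite_dimensional_eigenspace hc z⁻¹ (inv_ne_zero hz0)
    let ι : unboundedEigenspace L z →ₗ[ℂ] Module.End.eigenspace T.toLinearMap z⁻¹ :=
      (L.domain.subtype ∘ₗ (unboundedEigenspace L z).subtype).codRestrict _ fun ψ =>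
        Module.End.mem_eigenspace_iff.2 ((h.apply_eq_smul_iff hz0 _).1 ((hmem _).1 ψ.2))
    refine FiniteDimensional.of_injective ι fun a b hab => Subtype.ext (Subtype.ext ?_)
    have := congrArg Subtype.val hab
    exact this

/-! ### Unbounded operators that are invertible on their range -/

/-- If `S` is a right inverse of a symmetric operator `B`, then `K S K†` is symmetric. -/
theorem LinearMap.IsSymmetric.sandwich [CompleteSpace H] {R : Submodule ℂ H}
    [CompleteSpace R] {B S : R →L[ℂ] R} (hB : B.toLinearMap.IsSymmetric)
    (hBS : ∀ g, B (S g) = g) (K : R →L[ℂ] H) :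
    (K ∘L S ∘L K.adjoint).toLinearMap.IsSymmetric := by
  have hS : ∀ x y, ⟪S x, y⟫_ℂ = ⟪x, S y⟫_ℂ := fun x y => by
    conv_lhs => rw [← hBS y]
    conv_rhs => rw [← hBS x]
    exact (hB _ _).symm
  intro f g
  change ⟪K (S (K.adjoint f)), g⟫_ℂ = ⟪f, K (S (K.adjoint g))⟫_ℂ
  rw [← K.adjoint_inner_right, hS, K.adjoint_inner_left]

/-- The bounded operator `K` inverts the unbounded operator `D` on its range `R`. -/
structure IsRangeInverse (D : H →ₗ.[ℂ] H) {R : Submodule ℂ H} (K : R →L[ℂ] H) : Prop where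
  right : ∀ g : R, ∃ h : K g ∈ D.domain, D ⟨K g, h⟩ = g
  left : ∀ φ : D.domain, ∃ h : D φ ∈ R, K ⟨D φ, h⟩ = φ

namespace IsRangeInverse

variable {D : H →ₗ.[ℂ] H} {R : Submodule ℂ H} {K : R →L[ℂ] H}

theorem mem_domain (h : IsRangeInverse D K) (g : R) : K g ∈ D.domain := (h.right g).1

theorem apply_apply (h : IsRangeInverse D K) (g : R) : D ⟨K g, h.mem_domain g⟩ = g := (h.right g).2

theorem mem_range (h : IsRangeInverse D K) (φ : D.domain) : D φ ∈ R := (h.left φ).1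

theorem inv_apply (h : IsRangeInverse D K) (φ : D.domain) : K ⟨D φ, h.mem_range φ⟩ = φ :=
  (h.left φ).2

theorem injective (h : IsRangeInverse D K) : Function.Injective K := by
  intro f g hfg
  apply Subtype.ext
  rw [← h.apply_apply f, ← h.apply_apply g]
  simp only [hfg]

theorem domain_eq_range (h : IsRangeInverse D K) : D.domain = LinearMap.range K.toLinearMap := by
  ext ψ
  exact ⟨fun hψ => ⟨⟨D ⟨ψ, hψ⟩, h.mem_range _⟩, h.inv_apply ⟨ψ, hψ⟩⟩,
    fun ⟨g, hg⟩ => hg ▸ h.mem_domain g⟩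

variable [CompleteSpace R]

theorem isClosed (h : IsRangeInverse D K) : D.IsClosed := by
  have hR : IsClosed (R : Set H) := (completeSpace_coe_iff_isComplete.1 ‹_›).isClosed
  -- the graph is cut out by the continuous equation `x = K y` over the closed range
  have hs : (D.graph : Set (H × H)) = {p | p.2 ∈ R ∧ K (R.orthogonalProjectionOnto p.2) = p.1} := by
    ext ⟨x, y⟩
    simp only [SetLike.mem_coe, LinearPMap.mem_graph_iff, mem_ofPred_eq]
    constructor
    · rintro ⟨φ, rfl, rfl⟩
      refine ⟨h.mem_range φ, ?_⟩
      rw [show D φ = ((⟨D φ, h.mem_range φ⟩ : R) : H) from rfl,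
        Submodule.orthogonalProjectionOnto_mem_subspace_eq_self, h.inv_apply]
    · rintro ⟨hy, rfl⟩
      refine ⟨⟨_, h.mem_domain _⟩, rfl, ?_⟩
      rw [h.apply_apply, show y = ((⟨y, hy⟩ : R) : H) from rfl,
        Submodule.orthogonalProjectionOnto_mem_subspace_eq_self]
  rw [LinearPMap.IsClosed, hs]
  exact (hR.preimage continuous_snd).inter
    (isClosed_eq (by fun_prop) continuous_fst)

/-- The image of a dense subspace of the range under the bounded inverse is a core. -/
theorem hasCore (h : IsRangeInverse D K) {N : Submodule ℂ H} (hN : N ≤ D.domain)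
    {S : H → R} (hS : DenseRange S) (hSN : ∀ f, K (S f) ∈ N) : D.HasCore N := by
  have hcl := h.isClosed
  have hable : (D.domRestrict N).IsClosable :=
    hcl.isClosable.leIsClosable LinearPMap.domRestrict_le
  refine ⟨hN, LinearPMap.eq_of_eq_graph (le_antisymm ?_ ?_)⟩
  · rw [← hable.graph_closure_eq_closure_graph]
    exact Submodule.topologicalClosure_minimal _
      (LinearPMap.le_graph_of_le LinearPMap.domRestrict_le) hcl
  · rw [← hable.graph_closure_eq_closure_graph]
    rintro ⟨x, y⟩ hxy
    obtain ⟨φ, rfl, rfl⟩ := (LinearPMap.mem_graph_iff _).1 hxy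
    let Φ : R → H × H := fun g => (K g, g)
    have hΦ : Continuous Φ := K.continuous.prodMk continuous_subtype_val
    have h1 : Φ ⟨D φ, h.mem_range φ⟩ ∈ closure (Φ '' range S) :=
      image_closure_subset_closure_image hΦ ⟨_, hS _, rfl⟩
    have e : Φ ⟨D φ, h.mem_range φ⟩ = ((φ : H), D φ) := by simp only [Φ, h.inv_apply]
    rw [e] at h1
    refine closure_mono ?_ h1
    rintro _ ⟨_, ⟨f, rfl⟩, rfl⟩
    refine (LinearPMap.mem_graph_iff _).2 ⟨⟨K (S f), hSN f, h.mem_domain _⟩, rfl, ?_⟩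
    exact (LinearPMap.domRestrict_apply (y := ⟨K (S f), h.mem_domain _⟩) rfl).trans
      (h.apply_apply _)

variable [CompleteSpace H] {B S : R →L[ℂ] R}

theorem adjoint_injective (h : IsRangeInverse D K) (hD : Dense (D.domain : Set H)) :
    Function.Injective K.adjoint := by
  rw [h.domain_eq_range, Submodule.dense_iff_topologicalClosure_eq_top,
    Submodule.topologicalClosure_eq_top_iff, K.orthogonal_range] at hD
  exact LinearMap.ker_eq_bot.1 hD

theorem denseRange_adjoint (h : IsRangeInverse D K) : DenseRange K.adjoint := by
  have : Dense (LinearMap.range K.adjoint.toLinearMap : Set R) := by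
    rw [Submodule.dense_iff_topologicalClosure_eq_top, Submodule.topologicalClosure_eq_top_iff,
      ContinuousLinearMap.orthogonal_range, ContinuousLinearMap.adjoint_adjoint]
    exact LinearMap.ker_eq_bot.2 h.injective
  exact this

/-- Testing with the functions `φ = K g` turns the weak equation `⟪D φ, b⟫ = ⟪φ, f⟫` into
`b = K† f`. -/
theorem weak_iff (h : IsRangeInverse D K) (f : H) (b : R) :
    (∀ φ : D.domain, ⟪(φ : H), f⟫_ℂ = ⟪D φ, (b : H)⟫_ℂ) ↔ K.adjoint f = b := by
  constructor
  · intro hf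
    refine ext_inner_left ℂ fun g => ?_
    rw [ContinuousLinearMap.adjoint_inner_right]
    refine (hf ⟨K g, h.mem_domain g⟩).trans ?_
    rw [h.apply_apply]
    rfl
  · rintro rfl φ
    conv_lhs => rw [← h.inv_apply φ, ← ContinuousLinearMap.adjoint_inner_right]
    rfl

/-- If `S` inverts `B`, then `K S K† f` is the unique solution `ψ` of the weak equation
`⟪D φ, B D ψ⟫ = ⟪φ, f⟫`. -/
theorem sandwich_eq_iff (h : IsRangeInverse D K) (hBS : ∀ g, B (S g) = g) (hSB : ∀ g, S (B g) = g)
    (f : H) (ψ : D.domain) : (K ∘L S ∘L K.adjoint) f = ψ ↔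
      ∀ φ : D.domain, ⟪(φ : H), f⟫_ℂ = ⟪D φ, (B ⟨D ψ, h.mem_range ψ⟩ : H)⟫_ℂ := by
  rw [h.weak_iff]
  change K (S (K.adjoint f)) = ψ ↔ _
  constructor
  · intro hψ
    rw [← hBS (K.adjoint f), h.injective (hψ.trans (h.inv_apply ψ).symm)]
  · intro hf
    rw [hf, hSB, h.inv_apply]

end IsRangeInverse

end Abstract

/-! ### Compactness of integration -/

section InnerOperator

open scoped BoundedContinuousFunction

variable {H X : Type*} [NormedAddCommGroup H] [InnerProductSpace ℂ H] [TopologicalSpace X]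
  [CompactSpace X]

/-- The operator sending `g` to the continuous function `x ↦ ⟪Φ x, g⟫` on a compact space. -/
noncomputable def innerOperator (Φ : C(X, H)) : H →L[ℂ] X →ᵇ ℂ :=
  LinearMap.mkContinuous
    { toFun := fun g => BoundedContinuousFunction.mkOfCompact
        ⟨fun x => ⟪Φ x, g⟫_ℂ, Φ.continuous.inner continuous_const⟩
      map_add' := fun f g => by ext x; exact inner_add_right _ _ _
      map_smul' := fun c f => by ext x; exact inner_smul_right _ _ _ } ‖Φ‖ fun g =>
    (BoundedContinuousFunction.norm_le (by positivity)).2 fun x =>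
      (norm_inner_le_norm _ _).trans (mul_le_mul_of_nonneg_right (Φ.norm_coe_le_norm x)
        (norm_nonneg _))

theorem innerOperator_apply (Φ : C(X, H)) (g : H) (x : X) : innerOperator Φ g x = ⟪Φ x, g⟫_ℂ := rfl

/-- By the Arzelà–Ascoli theorem, as `Φ` is bounded and continuous. -/
theorem isCompactOperator_innerOperator (Φ : C(X, H)) : IsCompactOperator (innerOperator Φ) := by
  refine (isCompactOperator_iff_isCompact_closure_image_closedBall
    (innerOperator Φ).toLinearMap one_pos).2 ?_
  refine BoundedContinuousFunction.arzela_ascoli (Metric.closedBall 0 ‖Φ‖)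
    (isCompact_closedBall 0 _) _ ?_ ?_
  · rintro _ x ⟨g, hg, rfl⟩
    rw [mem_closedBall_zero_iff] at hg ⊢
    exact (norm_inner_le_norm _ _).trans
      ((mul_le_of_le_one_right (norm_nonneg _) hg).trans (Φ.norm_coe_le_norm x))
  · intro x₀
    rw [Metric.equicontinuousAt_iff_right]
    intro ε hε
    filter_upwards [Metric.continuousAt_iff'.1 Φ.continuous.continuousAt ε hε] with x hx
    rintro ⟨_, g, hg, rfl⟩
    rw [mem_closedBall_zero_iff] at hg
    change dist ⟪Φ x₀, g⟫_ℂ ⟪Φ x, g⟫_ℂ < ε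
    rw [dist_eq_norm, ← inner_sub_left]
    rw [dist_comm, dist_eq_norm] at hx
    exact ((norm_inner_le_norm _ _).trans (mul_le_of_le_one_right (norm_nonneg _) hg)).trans_lt hx

end InnerOperator

namespace CompactStarGraph

variable {V I : Type*} {G : CompactStarGraph V I}

section Primitive

variable (G) in
/-- The indicator functions of the intervals `(x, length j]`, as a continuous family in `L²`. -/
noncomputable def tailIndicator (j : I) : C(Icc 0 (G.length j), Lp ℂ 2 (G.edgeMeasure j)) where
  toFun x := indicatorConstLp 2 (measurableSet_Ioc (a := (x : ℝ)) (b := G.length j))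
    (measure_ne_top (G.edgeMeasure j) _) 1
  continuous_toFun := by
    refine continuous_indicatorConstLp_set (by simp) fun x => ?_
    have hle : ∀ y : Icc 0 (G.length j), G.edgeMeasure j
        (symmDiff (Ioc (y : ℝ) (G.length j)) (Ioc (x : ℝ) (G.length j))) ≤
        ENNReal.ofReal |(y : ℝ) - x| := fun y => by
      rw [← Real.volume_uIoc]
      refine (Measure.restrict_apply_le _ _).trans (measure_mono fun t ht => ?_)
      rw [mem_symmDiff, mem_Ioc, mem_Ioc] at ht
      rw [mem_uIoc]
      grind
    refine tendsto_of_tendsto_of_tendsto_of_le_of_le tendsto_const_nhds ?_ (fun _ => zero_le) hle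
    have : Continuous fun y : Icc 0 (G.length j) => ENNReal.ofReal |(y : ℝ) - x| :=
      ENNReal.continuous_ofReal.comp (by fun_prop)
    simpa using this.tendsto x

variable (G) in
/-- The primitive `x ↦ -∫ t in x..length j, g t` of a function on an edge, as a bounded operator: the
continuous function of inner products with `tailIndicator` is extended from the edge to `ℝ` by the
projection `projIcc` and then regarded as an element of `L²`. -/
noncomputable def edgePrimitive (j : I) :
    Lp ℂ 2 (G.edgeMeasure j) →L[ℂ] Lp ℂ 2 (G.edgeMeasure j) :=
  -(BoundedContinuousFunction.toLp 2 (G.edgeMeasure j) ℂ ∘L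
    BoundedContinuousFunction.compContinuousCLM ℂ ℂ
      ⟨projIcc 0 (G.length j) (G.length_pos j).le, continuous_projIcc⟩ ∘L
    innerOperator (G.tailIndicator j))

theorem isCompactOperator_edgePrimitive (j : I) : IsCompactOperator (G.edgePrimitive j) :=
  (((isCompactOperator_innerOperator (G.tailIndicator j)).clm_comp
    (BoundedContinuousFunction.compContinuousCLM ℂ ℂ
      ⟨projIcc 0 (G.length j) (G.length_pos j).le, continuous_projIcc⟩)).clm_comp
    (BoundedContinuousFunction.toLp 2 (G.edgeMeasure j) ℂ)).neg

theorem edgePrimitive_ae (j : I) (g : Lp ℂ 2 (G.edgeMeasure j)) :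
    G.edgePrimitive j g =ᵐ[G.edgeMeasure j] fun x => ∫ t in (G.length j)..x, g t := by
  have h1 := BoundedContinuousFunction.coeFn_toLp (p := 2) (μ := G.edgeMeasure j) (𝕜 := ℂ)
    ((innerOperator (G.tailIndicator j) g).compContinuous
      ⟨projIcc 0 (G.length j) (G.length_pos j).le, continuous_projIcc⟩)
  have h2 := Lp.coeFn_neg (BoundedContinuousFunction.toLp (E := ℂ) 2 (G.edgeMeasure j) ℂ
    ((innerOperator (G.tailIndicator j) g).compContinuous
      ⟨projIcc 0 (G.length j) (G.length_pos j).le, continuous_projIcc⟩))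
  have h3 : ∀ᵐ x ∂(G.edgeMeasure j), x ∈ Icc 0 (G.length j) := ae_restrict_mem measurableSet_Icc
  filter_upwards [h1, h2, h3] with x h1 h2 h3
  refine h2.trans ?_
  rw [Pi.neg_apply, h1, BoundedContinuousFunction.compContinuous_apply, innerOperator_apply]
  simp only [ContinuousMap.coe_mk, tailIndicator]
  have hr : (G.edgeMeasure j).restrict (Ioc x (G.length j)) =
      volume.restrict (Ioc x (G.length j)) := by
    rw [edgeMeasure, Measure.restrict_restrict measurableSet_Ioc, inter_eq_left.2]
    exact Ioc_subset_Icc_self.trans (Icc_subset_Icc_left h3.1)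
  rw [L2.inner_indicatorConstLp_one, intervalIntegral.integral_symm,
    intervalIntegral.integral_of_le h3.2, projIcc_of_mem _ h3, hr]

variable [Fintype I]

variable (G) in
/-- The primitive vanishing at the terminal vertices, as a bounded operator. -/
noncomputable def primitive : G.L2 →L[ℂ] G.L2 := by
  classical
  exact ∑ j, (PiLp.continuousLinearEquiv 2 ℂ fun j =>
      Lp ℂ 2 (G.edgeMeasure j)).symm.toContinuousLinearMap ∘L
    ContinuousLinearMap.single ℂ (fun j => Lp ℂ 2 (G.edgeMeasure j)) j ∘L G.edgePrimitive j ∘L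
    PiLp.proj 2 (fun j => Lp ℂ 2 (G.edgeMeasure j)) j

theorem primitive_apply (g : G.L2) (j : I) : G.primitive g j = G.edgePrimitive j (g j) := by
  classical
  simp [primitive, Finset.sum_apply]

theorem isCompactOperator_primitive : IsCompactOperator G.primitive := by
  classical
  refine Submodule.sum_mem (compactOperator (RingHom.id ℂ) G.L2 G.L2) fun j _ => ?_
  exact (((isCompactOperator_edgePrimitive j).comp_clm
    (PiLp.proj 2 (fun j => Lp ℂ 2 (G.edgeMeasure j)) j)).clm_comp
    (ContinuousLinearMap.single ℂ (fun j => Lp ℂ 2 (G.edgeMeasure j)) j)).clm_comp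
    (PiLp.continuousLinearEquiv 2 ℂ fun j =>
      Lp ℂ 2 (G.edgeMeasure j)).symm.toContinuousLinearMap

theorem isACRep_primitive (g : G.L2) :
    G.IsACRep (G.primitive g) g fun j x => ∫ t in (G.length j)..x, g j t where
  ac j := ac_integral (intervalIntegrable_L2 g j) right_mem_uIcc
  ae_eq j := by rw [primitive_apply]; exact edgePrimitive_ae j (g j)
  hasDeriv j := by
    rw [ae_edge]
    filter_upwards [(intervalIntegrable_L2 g j).ae_hasDerivAt_integral] with x hx hm
    exact hx hm _ right_mem_uIcc

end Primitive

/-! ### The gradient and its adjoint -/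

theorem _root_.AbsolutelyContinuousOnInterval.conj {F : ℝ → ℂ} {a b : ℝ}
    (hF : AbsolutelyContinuousOnInterval F a b) :
    AbsolutelyContinuousOnInterval (fun x => (starRingEnd ℂ) (F x)) a b := by
  rw [absolutelyContinuousOnInterval_iff] at hF ⊢
  simpa only [Complex.dist_conj_conj] using hF

section Gradient

variable [Fintype I]

theorem primitive_gradient (φ : G.gradient.domain) : G.primitive (G.gradient φ) = φ := by
  obtain ⟨F, h, -, h1⟩ := gradient_spec φ
  ext1 j
  refine Lp.ext ?_
  have hmem : ∀ᵐ x ∂(G.edgeMeasure j), x ∈ Icc 0 (G.length j) := ae_restrict_mem measurableSet_Icc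
  filter_upwards [(isACRep_primitive (G.gradient φ)).ae_eq j, h.ae_eq j, hmem] with x hx hF hm
  have hsub : uIcc (G.length j) x ⊆ uIcc 0 (G.length j) := by
    rw [uIcc_of_ge hm.2, uIcc_of_le (G.length_pos j).le]
    exact Icc_subset_Icc_left hm.1
  rw [hx, hF, ac_ftc ((h.ac j).mono hsub) ((intervalIntegrable_L2 _ j).mono_set hsub), h1 j,
    sub_zero]
  filter_upwards [(ae_edge j).1 (h.hasDeriv j)] with y hy hy'
  exact hy (hsub hy')

theorem isRangeInverse_primitive :
    IsRangeInverse G.gradient (G.primitive ∘L G.gradientRange.subtypeL) where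
  right g := by
    have hdom : G.primitive g ∈ G.gradient.domain := by
      refine ⟨g, _, isACRep_primitive (g : G.L2), fun i j => ?_, fun j => by simp⟩
      have := (mem_gradientRange_iff (g : G.L2)).1 g.2 i j
      rw [integral_edge, integral_edge] at this
      rw [intervalIntegral.integral_symm, this, ← intervalIntegral.integral_symm]
    exact ⟨hdom, gradient_eq ⟨_, hdom⟩ (isACRep_primitive (g : G.L2))⟩
  left φ := ⟨⟨φ, rfl⟩, primitive_gradient φ⟩

variable (G) in
/-- The function equal to the constant `c j` on the edge `j`. -/
noncomputable def edgeConst (c : I → ℂ) : G.L2 :=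
  WithLp.toLp 2 fun j => (memLp_const (μ := G.edgeMeasure j) (c j)).toLp

theorem edgeConst_ae (c : I → ℂ) (j : I) :
    G.edgeConst c j =ᵐ[G.edgeMeasure j] fun _ => c j :=
  (memLp_const (μ := G.edgeMeasure j) (c j)).coeFn_toLp

theorem isACRep_edgeConst (c : I → ℂ) : G.IsACRep (G.edgeConst c) 0 fun j _ => c j where
  ac j := ac_const _ _ _
  ae_eq j := edgeConst_ae c j
  hasDeriv j := by
    filter_upwards [Lp.coeFn_zero ℂ 2 (G.edgeMeasure j)] with x hx
    simp only [PiLp.zero_apply, hx, Pi.zero_apply]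
    exact hasDerivAt_const x _

theorem inner_edgeConst (g : G.L2) (c : I → ℂ) : ⟪G.edgeConst c, g⟫_ℂ =
    ∑ j, (starRingEnd ℂ) (c j) * ∫ x, g j x ∂(G.edgeMeasure j) := by
  rw [PiLp.inner_apply]
  refine Finset.sum_congr rfl fun j _ => ?_
  rw [L2.inner_def, ← integral_const_mul]
  refine integral_congr_ae ?_
  filter_upwards [edgeConst_ae (G := G) c j] with x hx
  rw [hx, RCLike.inner_apply, mul_comm]

theorem integral_edgeConst (c : I → ℂ) (j : I) :
    ∫ x, G.edgeConst c j x ∂(G.edgeMeasure j) = G.length j * c j := by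
  rw [integral_congr_ae (edgeConst_ae c j), integral_edge, intervalIntegral.integral_const]
  simp

/-- The orthogonal complement of the range of the gradient consists of edgewise constants whose
values add up to zero. -/
theorem exists_edgeConst_of_mem_orthogonal {h : G.L2} (hh : h ∈ G.gradientRangeᗮ) :
    ∃ c : I → ℂ, ∑ j, c j = 0 ∧ h = G.edgeConst c := by
  have hlen : ∀ j, (G.length j : ℂ) ≠ 0 := fun j => by exact_mod_cast (G.length_pos j).ne'
  -- the edgewise mean values of `h`
  let c : I → ℂ := fun j => (G.length j : ℂ)⁻¹ * ∫ x, h j x ∂(G.edgeMeasure j)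
  have hint : ∀ j, ∫ x, (h - G.edgeConst c) j x ∂(G.edgeMeasure j) = 0 := fun j => by
    have e : ∫ x, (h - G.edgeConst c) j x ∂(G.edgeMeasure j) =
        ∫ x, h j x - G.edgeConst c j x ∂(G.edgeMeasure j) :=
      integral_congr_ae (Lp.coeFn_sub (h j) (G.edgeConst c j))
    rw [e, integral_sub ((Lp.memLp _).integrable (by norm_num))
      ((Lp.memLp _).integrable (by norm_num)), integral_edgeConst, mul_inv_cancel_left₀ (hlen j),
      sub_self]
  have hmem : h - G.edgeConst c ∈ G.gradientRange :=
    (mem_gradientRange_iff _).2 fun i j => (hint i).trans (hint j).symm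
  have h0 : h - G.edgeConst c = 0 := by
    rw [← inner_self_eq_zero (𝕜 := ℂ), inner_sub_left, inner_edgeConst,
      Submodule.inner_left_of_mem_orthogonal hmem hh]
    simp only [hint, mul_zero, Finset.sum_const_zero, sub_zero]
  have hc := sub_eq_zero.1 h0
  refine ⟨c, ?_, hc⟩
  -- the function `1 / length j` has integral one over every edge
  have hu : G.edgeConst (fun j => (G.length j : ℂ)⁻¹) ∈ G.gradientRange := by
    refine (mem_gradientRange_iff _).2 fun i j => ?_
    rw [integral_edgeConst, integral_edgeConst, mul_inv_cancel₀ (hlen i), mul_inv_cancel₀ (hlen j)]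
  have := Submodule.inner_right_of_mem_orthogonal hu hh
  rw [inner_edgeConst] at this
  simpa [c] using this

/-- Integration by parts on the graph. -/
theorem IsACRep.inner_add_inner {φ φ' g g' : G.L2} {F E : I → ℝ → ℂ} (h : G.IsACRep φ φ' F)
    (k : G.IsACRep g g' E) : ⟪φ', g⟫_ℂ + ⟪φ, g'⟫_ℂ =
      ∑ j, ((starRingEnd ℂ) (F j (G.length j)) * E j (G.length j) -
        (starRingEnd ℂ) (F j 0) * E j 0) := by
  rw [PiLp.inner_apply, PiLp.inner_apply, ← Finset.sum_add_distrib]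
  refine Finset.sum_congr rfl fun j _ => ?_
  have hi := (L2.integrable_inner (𝕜 := ℂ) (φ' j) (g j)).add
    (L2.integrable_inner (𝕜 := ℂ) (φ j) (g' j))
  rw [L2.inner_def, L2.inner_def, ← integral_add (L2.integrable_inner _ _)
    (L2.integrable_inner _ _), integral_edge]
  refine ac_ftc (F := fun x => (starRingEnd ℂ) (F j x) * E j x) ((h.ac j).conj.smul (k.ac j)) ?_
    ((ae_edge j).1 ?_)
  · rw [intervalIntegrable_iff_integrableOn_Icc_of_le (G.length_pos j).le]
    exact hi
  · filter_upwards [h.ae_eq j, k.ae_eq j, h.hasDeriv j, k.hasDeriv j] with x h1 k1 h2 k2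
    have e : ⟪φ' j x, g j x⟫_ℂ + ⟪φ j x, g' j x⟫_ℂ =
        star (φ' j x) * E j x + star (F j x) * g' j x := by
      rw [h1, k1, RCLike.inner_apply, RCLike.inner_apply, starRingEnd_apply, starRingEnd_apply]
      ring
    rw [e]
    exact h2.star.mul k2

/-- The adjoint of the gradient is minus the derivative, with the flux condition at the central
vertex. -/
theorem weak_gradient_iff (f g : G.L2) :
    (∀ φ : G.gradient.domain, ⟪(φ : G.L2), f⟫_ℂ = ⟪G.gradient φ, g⟫_ℂ) ↔
      ∃ E, G.IsACRep g (-f) E ∧ ∑ j, E j 0 = 0 := by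
  have back : ∀ {g : G.L2} {E : I → ℝ → ℂ}, G.IsACRep g (-f) E → ∑ j, E j 0 = 0 →
      ∀ φ : G.gradient.domain, ⟪(φ : G.L2), f⟫_ℂ = ⟪G.gradient φ, g⟫_ℂ := by
    intro g E k hE φ
    obtain ⟨F, h, h0, h1⟩ := gradient_spec φ
    have hsum : ∑ j, (starRingEnd ℂ) (F j 0) * E j 0 = 0 := by
      cases isEmpty_or_nonempty I with
      | inl _ => simp
      | inr hI =>
        obtain ⟨i⟩ := hI
        rw [Finset.sum_congr rfl fun j _ => by rw [h0 j i], ← Finset.mul_sum, hE, mul_zero]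
    have := h.inner_add_inner k
    simp only [h1, map_zero, zero_mul, zero_sub, Finset.sum_neg_distrib, hsum, neg_zero,
      inner_neg_right, add_neg_eq_zero] at this
    exact this.symm
  constructor
  · intro hw
    -- a primitive of `-f` that vanishes at the central vertex
    have hΓ := (isACRep_primitive (-f)).add
      (isACRep_edgeConst (G := G) fun j => -∫ t in (G.length j)..0, (-f) j t)
    rw [add_zero] at hΓ
    have hw' := back hΓ (by simp)
    have horth : g - (G.primitive (-f) + G.edgeConst fun j =>
        -∫ t in (G.length j)..0, (-f) j t) ∈ G.gradientRangeᗮ := by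
      rintro _ ⟨φ, rfl⟩
      rw [inner_sub_right, sub_eq_zero]
      exact (hw φ).symm.trans (hw' φ)
    obtain ⟨c, hc, hg⟩ := exists_edgeConst_of_mem_orthogonal horth
    have := hΓ.add (isACRep_edgeConst (G := G) c)
    rw [← hg, add_zero, add_sub_cancel] at this
    exact ⟨_, this, by simpa using hc⟩
  · rintro ⟨E, k, hE⟩
    exact back k hE

theorem dense_gradient_domain : Dense (G.gradient.domain : Set G.L2) := by
  rw [Submodule.dense_iff_topologicalClosure_eq_top, Submodule.topologicalClosure_eq_top_iff,
    Submodule.eq_bot_iff]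
  intro f hf
  obtain ⟨E, hE, -⟩ := (weak_gradient_iff f 0).1 fun φ => by
    rw [inner_zero_right, hf φ φ.2]
  exact neg_eq_zero.1 (hE.deriv_unique .zero)

/-! ### The multiplication operator and its compression -/

theorem mulOp_isSymmetric (A : G.RealLinfty) : (mulOp A).toLinearMap.IsSymmetric := by
  intro f g
  change ⟪mulOp A f, g⟫_ℂ = ⟪f, mulOp A g⟫_ℂ
  rw [PiLp.inner_apply, PiLp.inner_apply]
  refine Finset.sum_congr rfl fun j _ => ?_
  rw [L2.inner_def, L2.inner_def]
  refine integral_congr_ae ?_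
  filter_upwards [mulOp_ae A f j, mulOp_ae A g j] with x hf hg
  rw [hf, hg]
  simp only [RCLike.inner_apply, map_mul, Complex.conj_ofReal]
  ring

theorem inner_compression (A : G.RealLinfty) (f g : G.gradientRange) :
    ⟪(f : G.L2), (compression A g : G.L2)⟫_ℂ = ⟪(f : G.L2), mulOp A g⟫_ℂ :=
  Submodule.inner_orthogonalProjectionOnto_eq_of_mem_left f _

theorem compression_isSymmetric (A : G.RealLinfty) :
    (compression A).toLinearMap.IsSymmetric := fun f g => by
  change ⟪(compression A f : G.L2), (g : G.L2)⟫_ℂ = ⟪(f : G.L2), (compression A g : G.L2)⟫_ℂ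
  rw [inner_compression, ← inner_conj_symm, inner_compression, inner_conj_symm]
  exact mulOp_isSymmetric A _ _

/-! ### The solution operator -/

/-- The operator `T = K (Q M_A Q*)⁻¹ K*`, where `K` is the bounded inverse of the gradient on its
range, solves the weak equation `⟪φ', A ψ'⟫ = ⟪φ, f⟫`. -/
theorem exists_solutionOperator {A : G.RealLinfty} (hA : IsUnit (compression A)) :
    ∃ T : G.L2 →L[ℂ] G.L2, T.toLinearMap.IsSymmetric ∧ Function.Injective T ∧
      IsCompactOperator T ∧ (∀ f, T f ∈ G.gradient.domain) ∧
      (∀ (f : G.L2) (ψ : G.gradient.domain), T f = ψ ↔ ∀ φ : G.gradient.domain,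
        ⟪(φ : G.L2), f⟫_ℂ = ⟪G.gradient φ, mulOp A (G.gradient ψ)⟫_ℂ) ∧
      G.gradient.HasCore (LinearMap.range T.toLinearMap) := by
  obtain ⟨u, hu⟩ := hA
  have hK := isRangeInverse_primitive (G := G)
  let K : G.gradientRange →L[ℂ] G.L2 := G.primitive ∘L G.gradientRange.subtypeL
  have hD := dense_gradient_domain (G := G)
  let S : G.gradientRange →L[ℂ] G.gradientRange := u⁻¹.1
  have hBS : ∀ g, compression A (S g) = g := fun g => by
    rw [← hu]
    exact congrArg (fun R : G.gradientRange →L[ℂ] G.gradientRange => R g) u.mul_inv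
  have hSB : ∀ g, S (compression A g) = g := fun g => by
    rw [← hu]
    exact congrArg (fun R : G.gradientRange →L[ℂ] G.gradientRange => R g) u.inv_mul
  let T : G.L2 →L[ℂ] G.L2 := K ∘L S ∘L K.adjoint
  have hTsymm : T.toLinearMap.IsSymmetric := (compression_isSymmetric A).sandwich hBS K
  have hTinj : Function.Injective T :=
    hK.injective.comp ((Function.LeftInverse.injective hBS).comp (hK.adjoint_injective hD))
  have hTc : IsCompactOperator T := isCompactOperator_primitive.comp_clm
    (G.gradientRange.subtypeL ∘L S ∘L K.adjoint)
  have hweak : ∀ (f : G.L2) (ψ : G.gradient.domain), T f = ψ ↔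
      ∀ φ : G.gradient.domain, ⟪(φ : G.L2), f⟫_ℂ = ⟪G.gradient φ, mulOp A (G.gradient ψ)⟫_ℂ := by
    intro f ψ
    rw [hK.sandwich_eq_iff hBS hSB]
    refine forall_congr' fun φ => ?_
    rw [inner_compression A ⟨G.gradient φ, hK.mem_range φ⟩ ⟨G.gradient ψ, hK.mem_range ψ⟩]
  have hTD : ∀ f, T f ∈ G.gradient.domain := fun f => hK.mem_domain _
  refine ⟨T, hTsymm, hTinj, hTc, hTD, hweak, ?_⟩
  refine hK.hasCore (S := S ∘ K.adjoint) ?_ ?_ fun f => ⟨f, rfl⟩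
  · rintro _ ⟨f, rfl⟩
    exact hTD f
  · exact (Function.RightInverse.surjective hSB).denseRange.comp hK.denseRange_adjoint
      S.continuous

end Gradient

end CompactStarGraph

open CompactStarGraph

theorem theorem5p1 {V I : Type*} [Fintype I] (G : CompactStarGraph V I) (A : G.RealLinfty)
    (hA : IsUnit (CompactStarGraph.compression A)) :
    ∃ L : G.L2 →ₗ.[ℂ] G.L2,
      CompactStarGraph.Represents A L ∧
      (∀ L' : G.L2 →ₗ.[ℂ] G.L2, CompactStarGraph.Represents A L' → L' = L) ∧
      (∀ ψ : G.L2, ψ ∈ L.domain ↔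
        ∃ h : ψ ∈ G.gradient.domain, CompactStarGraph.mulOp A (G.gradient ⟨ψ, h⟩) ∈ G.fluxH1) ∧
      (∀ ψ : L.domain, ∃ (h : (ψ : G.L2) ∈ G.gradient.domain)
        (h' : CompactStarGraph.mulOp A (G.gradient ⟨ψ, h⟩) ∈ G.gradient.adjoint.domain),
          L ψ = G.gradient.adjoint ⟨CompactStarGraph.mulOp A (G.gradient ⟨ψ, h⟩), h'⟩) ∧
      G.gradient.HasCore L.domain ∧
      (∃ R : G.L2 →L[ℂ] G.L2, IsBoundedInverse L R ∧ IsCompactOperator R) ∧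
      HasDiscreteSpectrum L := by
  obtain ⟨T, hTsymm, hTinj, hTc, hTD, hweak, hcore⟩ := exists_solutionOperator hA
  obtain ⟨L, hL⟩ : ∃ L, IsBoundedInverse L T := ⟨_, isBoundedInverse_unboundedInverse T hTinj⟩
  have hLsa : IsSelfAdjoint L := hL.isSelfAdjoint hTsymm
  have hLD : L.domain ≤ G.gradient.domain := by
    rw [hL.domain_eq_range]
    rintro _ ⟨f, rfl⟩
    exact hTD f
  have hform : ∀ (φ : G.gradient.domain) (ψ : L.domain),
      ⟪(φ : G.L2), L ψ⟫_ℂ = ⟪G.gradient φ, mulOp A (G.gradient ⟨ψ, hLD ψ.2⟩)⟫_ℂ :=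
    fun φ ψ => (hweak (L ψ) ⟨ψ, hLD ψ.2⟩).1 (hL.2 ψ) φ
  refine ⟨L, ⟨hLsa, hLD, hform⟩, ?_, ?_, ?_, ?_, ⟨T, hL, hTc⟩, hL.hasDiscreteSpectrum hTc hTsymm⟩
  · intro L' hL'
    have hT : ∀ ψ : L'.domain, T (L' ψ) = ψ := fun ψ =>
      (hweak (L' ψ) ⟨ψ, hL'.domain_le ψ.2⟩).2 fun φ => hL'.form_eq φ ψ
    refine hLsa.eq_of_le hL'.selfAdjoint (LinearPMap.le_of_le_graph ?_)
    rintro ⟨x, y⟩ hxy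
    obtain ⟨ψ, rfl, rfl⟩ := (LinearPMap.mem_graph_iff _).1 hxy
    exact (LinearPMap.mem_graph_iff _).2 ⟨⟨T (L' ψ), hL.mem_domain _⟩, hT ψ, hL.apply_apply _⟩
  · intro ψ
    constructor
    · intro hψ
      obtain ⟨E, hE, hE0⟩ := (weak_gradient_iff (L ⟨ψ, hψ⟩) _).1 fun φ => hform φ ⟨ψ, hψ⟩
      exact ⟨hLD hψ, _, E, hE, hE0⟩
    · rintro ⟨h, g, E, hE, hE0⟩
      rw [← neg_neg g] at hE
      have := (hweak (-g) ⟨ψ, h⟩).2 ((weak_gradient_iff _ _).2 ⟨E, hE, hE0⟩)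
      have hmem := hL.mem_domain (-g)
      rwa [this] at hmem
  · intro ψ
    have hadj : ∀ φ : G.gradient.domain, ⟪L ψ, (φ : G.L2)⟫_ℂ =
        ⟪mulOp A (G.gradient ⟨ψ, hLD ψ.2⟩), G.gradient φ⟫_ℂ := fun φ => by
      have := congrArg (starRingEnd ℂ) (hform φ ψ)
      rwa [inner_conj_symm, inner_conj_symm] at this
    exact ⟨hLD ψ.2, LinearPMap.exists_adjoint_apply_eq dense_gradient_domain hadj⟩
  · rwa [hL.domain_eq_range]
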